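/- Let $d\ge 0$, $n\ge 0$ be integers, let $\mathcal W\subset\mathbb R^d$ be a nonempty closed convex set, and let $\Pi_{\mathcal W}$ be the Euclidean projection onto $\mathcal W$. For $t=1,\dots,n$ let $\Psi_t:\mathcal W\to\mathbb R^d$ be measurable and $\sigma_t>0$, and suppose that there is $D>0$ such that the set $\{\Psi_t(w):w\in\mathcal W\}$ has diameter $D$ for every $t\in\{1,\dots,n\}$. Consider the iteration $$W_{t+1}=\Pi_{\mathcal W}\big(\Psi_t(W_t)+\sigma_t Z_t\big),\qquad t=1,\dots,n,$$ where $Z_1,\dots,Z_n$ are i.i.d. $\mathcal N(0,\mathbf I_d)$ and independent of the initial point $W_1$. Let $\mu_1,\mu_1'$ be probability measures on $\mathcal W$, and let $\mu_{n+1}$ and $\mu'_{n+1}$ be the laws of the output after $n$ steps when the iteration is started from $W_1\sim\mu_1$ and from $W_1'\sim\mu_1'$, respectively. For $\gamma\ge1$ and probability measures $\mu,\nu$ on the same space, let $\mathsf E_\gamma(\mu\|\nu)=\int \mathrm d(\mu-\gamma\nu)^+$ be the total mass of the positive part of the signed measure $\mu-\gamma\nu$. Then, for every $\gamma\ge 1$,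 $$\mathsf E_\gamma(\mu_{n+1}\|\mu'_{n+1})\le \mathsf E_\gamma(\mu_1\|\mu_1')\prod_{t=1}^n\theta_\gamma\Big(\frac{D}{\sigma_t}\Big),$$ where $\theta_\gamma(r)=\mathsf Q\big(\frac{\log\gamma}{r}-\frac r2\big)-\gamma\,\mathsf Q\big(\frac{\log\gamma}{r}+\frac r2\big)$ for $r>0$ and $\mathsf Q(a)=\frac1{\sqrt{2\pi}}\int_a^\infty e^{-u^2/2}\,\mathrm du$. -/

import Mathlib

open MeasureTheory ProbabilityTheory

/-- The Euclidean space `ℝ^d`. -/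
abbrev Euc (d : ℕ) : Type := EuclideanSpace ℝ (Fin d)

/-- The `E_γ`-divergence (hockey-stick divergence) `E_γ(μ‖ν) = ∫ d(μ - γ ν)⁺`: the total mass of
the positive part, in the Jordan decomposition, of the signed measure `μ - γ ν`. -/
noncomputable def EGamma {α : Type*} [MeasurableSpace α] (γ : ℝ) (μ ν : Measure α)
    [IsFiniteMeasure μ] [IsFiniteMeasure ν] : ℝ :=
  (μ.toSignedMeasure - γ • ν.toSignedMeasure).toJordanDecomposition.posPart.real Set.univ

/-- The Gaussian tail function `Q(a) = (1 / √(2π)) ∫_a^∞ exp(-u² / 2) du`. -/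
noncomputable def gaussianQ (a : ℝ) : ℝ :=
  1 / √(2 * Real.pi) * ∫ u in Set.Ioi a, Real.exp (-u ^ 2 / 2)

/-- `θ_γ(r) = Q(log γ / r - r / 2) - γ Q(log γ / r + r / 2)`, for `r > 0`. -/
noncomputable def theta (γ r : ℝ) : ℝ :=
  gaussianQ (Real.log γ / r - r / 2) - γ * gaussianQ (Real.log γ / r + r / 2)

/-- The projection operator onto a nonempty closed set `K ⊆ ℝ^d`: it sends `x` to a point of `K`
at minimal distance from `x`. When `K` is convex, this point is unique
(see `projOnto_eq_of_convex`). -/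
noncomputable def projOnto {d : ℕ} (K : Set (Euc d)) (hne : K.Nonempty) (hcl : IsClosed K)
    (x : Euc d) : K :=
  ⟨(hcl.exists_infDist_eq_dist hne x).choose, (hcl.exists_infDist_eq_dist hne x).choose_spec.1⟩

theorem projOnto_dist {d : ℕ} (K : Set (Euc d)) (hne : K.Nonempty) (hcl : IsClosed K)
    (x : Euc d) {y : Euc d} (hy : y ∈ K) :
    dist x (projOnto K hne hcl x : Euc d) ≤ dist x y := by
  have h := (hcl.exists_infDist_eq_dist hne x).choose_spec.2
  have h' := Metric.infDist_le_dist_of_mem (x := x) hy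
  exact h ▸ h'

theorem projOnto_eq_of_convex {d : ℕ} (K : Set (Euc d)) (hne : K.Nonempty) (hcl : IsClosed K)
    (hcv : Convex ℝ K) (x : Euc d) (p : K) (hp : ∀ y ∈ K, dist x (p : Euc d) ≤ dist x y) :
    projOnto K hne hcl x = p := by
  have key : ∀ q : K, (∀ y ∈ K, dist x (q : Euc d) ≤ dist x y) →
      ∀ w ∈ K, inner ℝ (x - (q : Euc d)) (w - (q : Euc d)) ≤ 0 := by
    intro q hq
    apply (norm_eq_iInf_iff_real_inner_le_zero hcv q.2).1
    have : Nonempty K := hne.to_subtype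
    apply le_antisymm
    · exact le_ciInf fun w => by simpa [dist_eq_norm] using hq w w.2
    · exact ciInf_le (f := fun w : K => ‖x - (w : Euc d)‖)
        ⟨0, by rintro _ ⟨w, rfl⟩; exact norm_nonneg _⟩ q
  have h1 := key p hp _ (projOnto K hne hcl x).2
  have h2 := key _ (fun y hy => projOnto_dist K hne hcl x hy) _ p.2
  set q := projOnto K hne hcl x
  have h3 : inner ℝ ((q : Euc d) - p) ((q : Euc d) - p) ≤ 0 := by
    have e : inner ℝ ((q : Euc d) - p) ((q : Euc d) - p)
        = inner ℝ (x - (p : Euc d)) ((q : Euc d) - p)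
          + inner ℝ (x - (q : Euc d)) ((p : Euc d) - q) := by
      simp only [inner_sub_left, inner_sub_right]; ring
    linarith
  have h4 : (q : Euc d) - p = 0 := by
    rw [real_inner_self_eq_norm_sq] at h3
    exact norm_eq_zero.1 (pow_eq_zero_iff (two_ne_zero) |>.1 (le_antisymm h3 (sq_nonneg _)))
  exact Subtype.ext (sub_eq_zero.1 h4)

/-- `W 0, …, W n` (the iterates `W_1, …, W_{n+1}`) is a run, on the probability space `(Ω, P)`, of
the projected noisy iteration `W_{t+1} = Π_K (Ψ_t(W_t) + σ_t Z_t)` with initial law `μ₁`, driven by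
i.i.d. standard Gaussian noise `Z` independent of the initial point. -/
structure IsProjectedNoisyIteration {d n : ℕ} (K : Set (Euc d)) (hne : K.Nonempty)
    (hcl : IsClosed K) (Ψ : Fin n → K → Euc d) (σ : Fin n → ℝ) (μ₁ : Measure K)
    {Ω : Type*} [MeasurableSpace Ω] (P : Measure Ω)
    (Z : Fin n → Ω → Euc d) (W : Fin (n + 1) → Ω → K) : Prop where
  init_law : HasLaw (W 0) μ₁ P
  noise_law : ∀ t, HasLaw (Z t) (stdGaussian (Euc d)) P
  noise_indep : iIndepFun Z P
  init_indep_noise : IndepFun (W 0) (fun ω t => Z t ω) P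
  step : ∀ t : Fin n, ∀ᵐ ω ∂P,
    W t.succ ω = projOnto K hne hcl (Ψ t (W t.castSucc ω) + σ t • Z t ω)

/-!
Each step of the iteration applies the Markov kernel `w ↦ law of Π_K (Ψ_t(w) + σ_t Z)` to the law of
the iterate, because the iterate at time `t` is a function of the initial point and of the earlier
noise, hence independent of `Z_t` (`IsProjectedNoisyIteration.map_succ_eq`). It therefore suffices
that this kernel contracts `E_γ` by the factor `θ_γ(D / σ_t)`.

The divergence is a maximum over test sets, `E_γ(μ‖ν) = max_A (μ(A) - γ ν(A))`, and for `γ ≥ 1` a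
Markov kernel `κ` contracts it by any `θ` with `κ_x(A) - γ κ_y(A) ≤ θ` for all `x`, `y`, `A`
(`integral_sub_le_mul_EGamma`): write `μ - γ ν` as the difference of its Jordan parts, of masses
`E ≤ 1` and `E + γ - 1`, and bound `κ_x(A)` above on the first and below on the second.

For the kernel at hand, a test set may be pulled back through the projection, so that the bound
concerns two Gaussians `N(m, σ²I)` and `N(m', σ²I)` with `‖m - m'‖ ≤ D`
(`stdGaussian_affine_sub_le_theta`). With `v = (m - m') / D`, a vector of norm at most one, a
standard Gaussian is `t v + (I - v vᵀ)^{1/2} y` with `t` and `y` independent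
(`stdGaussian_eq_map_prod`); given `y`, the two Gaussians become `N(D / σ, 1)` and `N(0, 1)` in the
variable `t`. In dimension one the bound is the Neyman–Pearson lemma
(`gaussianReal_sub_le_theta`).
-/

/-! ### The hockey-stick divergence and mixtures -/

/-- The Jordan decomposition `μ - γ ν = p - q`, written without subtraction. -/
theorem measureReal_add_negPart {α : Type*} [MeasurableSpace α] (γ : ℝ) (μ ν : Measure α)
    [IsFiniteMeasure μ] [IsFiniteMeasure ν] {A : Set α} (hA : MeasurableSet A) :
    μ.real A
        + (μ.toSignedMeasure - γ • ν.toSignedMeasure).toJordanDecomposition.negPart.real A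
      = γ * ν.real A
        + (μ.toSignedMeasure - γ • ν.toSignedMeasure).toJordanDecomposition.posPart.real A := by
  have h := (μ.toSignedMeasure - γ • ν.toSignedMeasure).apply_eq_posPart_real_sub_negPart_real hA
  have e : (μ.toSignedMeasure - γ • ν.toSignedMeasure) A = μ.real A - γ * ν.real A := by
    rw [_root_.sub_apply, _root_.smul_apply,
      Measure.toSignedMeasure_apply_measurable hA, Measure.toSignedMeasure_apply_measurable hA,
      smul_eq_mul]
  linarith

/-- `E_γ(μ‖ν)` is attained on a Hahn set of `μ - γ ν`. -/
theorem exists_EGamma_eq {α : Type*} [MeasurableSpace α] (γ : ℝ) (μ ν : Measure α)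
    [IsFiniteMeasure μ] [IsFiniteMeasure ν] :
    ∃ A, MeasurableSet A ∧ EGamma γ μ ν = μ.real A - γ * ν.real A := by
  set j := (μ.toSignedMeasure - γ • ν.toSignedMeasure).toJordanDecomposition with hj
  obtain ⟨S, hS, h1, h2⟩ := j.mutuallySingular
  refine ⟨Sᶜ, hS.compl, ?_⟩
  have h3 := measureReal_add_negPart γ μ ν hS.compl
  rw [← hj] at h3
  have h4 : j.negPart.real Sᶜ = 0 := by simp [Measure.real, h2]
  have h5 : j.posPart.real S = 0 := by simp [Measure.real, h1]
  have h6 := measureReal_add_measureReal_compl (μ := j.posPart) hS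
  have h7 : EGamma γ μ ν = j.posPart.real Set.univ := rfl
  linarith

/-- The Dobrushin-type contraction for `E_γ`, tested on one function: here `f x` is the probability
that a Markov kernel started at `x` hits a fixed set, and `θ` bounds
`κ_x(A) - γ κ_y(A)` uniformly in `x`, `y`. -/
theorem integral_sub_le_mul_EGamma {α : Type*} [MeasurableSpace α] {γ : ℝ} (hγ : 1 ≤ γ)
    (μ ν : Measure α) [IsProbabilityMeasure μ] [IsProbabilityMeasure ν] {f : α → ℝ}
    (hf : Measurable f) (h0 : ∀ x, 0 ≤ f x) (h1 : ∀ x, f x ≤ 1) {θ : ℝ}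
    (hosc : ∀ x y, f x ≤ θ + γ * f y) :
    ∫ x, f x ∂μ - γ * ∫ x, f x ∂ν ≤ θ * EGamma γ μ ν := by
  have hγ0 : 0 ≤ γ := by linarith
  have hE1 : EGamma γ μ ν ≤ 1 := by
    obtain ⟨A, -, hA⟩ := exists_EGamma_eq γ μ ν
    have : 0 ≤ γ * ν.real A := by positivity
    have := measureReal_le_one (μ := μ) (s := A)
    linarith
  have hcons := fun A hA ↦ measureReal_add_negPart γ μ ν (A := A) hA
  have hE : EGamma γ μ ν
    = (μ.toSignedMeasure - γ • ν.toSignedMeasure).toJordanDecomposition.posPart.real Set.univ := rfl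
  set p := (μ.toSignedMeasure - γ • ν.toSignedMeasure).toJordanDecomposition.posPart
  set q := (μ.toSignedMeasure - γ • ν.toSignedMeasure).toJordanDecomposition.negPart
  set E := EGamma γ μ ν
  have hq : q.real Set.univ = E + γ - 1 := by
    have := hcons _ MeasurableSet.univ
    simp only [probReal_univ] at this
    linarith
  have hmeas : μ + q = γ.toNNReal • ν + p := by
    ext A hA
    have h := hcons A hA
    rw [← measureReal_eq_measureReal_iff, measureReal_add_apply, measureReal_add_apply, h]
    simp [Real.coe_toNNReal _ hγ0, Measure.real]
  have hint (ρ : Measure α) [IsFiniteMeasure ρ] : Integrable f ρ :=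
    Integrable.of_bound hf.aestronglyMeasurable 1
      (ae_of_all _ fun x ↦ by rw [Real.norm_of_nonneg (h0 x)]; exact h1 x)
  have key : ∫ x, f x ∂μ + ∫ x, f x ∂q = γ * ∫ x, f x ∂ν + ∫ x, f x ∂p := by
    have : ∫ x, f x ∂(μ + q) = ∫ x, f x ∂(γ.toNNReal • ν + p) := by rw [hmeas]
    rw [integral_add_measure (hint _) (hint _), integral_add_measure (hint _) (hint _),
      integral_smul_nnreal_measure, NNReal.smul_def, Real.coe_toNNReal _ hγ0, smul_eq_mul] at this
    exact this
  have : Nonempty α := nonempty_of_isProbabilityMeasure μ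
  set i := ⨅ x, f x
  have hbdd : BddBelow (Set.range f) := ⟨0, by rintro _ ⟨x, rfl⟩; exact h0 x⟩
  have hi0 : 0 ≤ i := le_ciInf h0
  have hup (x : α) : f x ≤ θ + γ * i := by
    have h : (f x - θ) / γ ≤ i := le_ciInf fun y ↦ by
      rw [div_le_iff₀ (by linarith)]; linarith [hosc x y]
    rw [div_le_iff₀ (by linarith)] at h
    linarith
  -- `∫ f dμ - γ ∫ f dν = ∫ f dp - ∫ f dq`, where `f ≤ θ + γ i` on `p`, of mass `E`, and `f ≥ i`
  -- on `q`, of mass `E + γ - 1`. The excess over `θ E` is then at most `(γ - 1) i (E - 1) ≤ 0`.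
  have hp_le : ∫ x, f x ∂p ≤ (θ + γ * i) * E := by
    calc ∫ x, f x ∂p ≤ ∫ _, (θ + γ * i) ∂p :=
          integral_mono (hint p) (integrable_const _) hup
      _ = _ := by rw [integral_const, hE, smul_eq_mul, mul_comm]
  have hq_ge : i * (E + γ - 1) ≤ ∫ x, f x ∂q := by
    calc i * (E + γ - 1) = ∫ _, i ∂q := by rw [integral_const, hq, smul_eq_mul, mul_comm]
      _ ≤ _ := integral_mono (integrable_const _) (hint q) fun x ↦ ciInf_le hbdd x
  have h9 : 0 ≤ (γ - 1) * i * (1 - E) :=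
    mul_nonneg (mul_nonneg (by linarith) hi0) (by linarith)
  nlinarith

/-! ### Gaussian measures on the line -/

theorem gaussianReal_real_Ioi (m a : ℝ) :
    (gaussianReal m 1).real (Set.Ioi a) = gaussianQ (a - m) := by
  have h := gaussianReal_map_add_const (μ := 0) (v := 1) m
  rw [zero_add] at h
  rw [← h, map_measureReal_apply (by fun_prop) measurableSet_Ioi]
  have e : (fun x : ℝ ↦ x + m) ⁻¹' Set.Ioi a = Set.Ioi (a - m) := by
    ext x; simp [sub_lt_iff_lt_add]
  rw [e, Measure.real, gaussianReal_apply_eq_integral _ one_ne_zero, ENNReal.toReal_ofReal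
    (integral_nonneg fun x ↦ gaussianPDFReal_nonneg _ _ _), gaussianQ, ← integral_const_mul]
  simp [gaussianPDFReal]

/-- The Neyman–Pearson bound: `N(r, 1)(B) - γ N(0, 1)(B)` is largest on the half-line where the
likelihood ratio `exp (r x - r² / 2)` exceeds `γ`, and its value there is `θ_γ(r)`. -/
theorem gaussianReal_sub_le_theta {γ r : ℝ} (hγ : 1 ≤ γ) (hr : 0 < r) {B : Set ℝ}
    (hB : MeasurableSet B) :
    (gaussianReal r 1).real B - γ * (gaussianReal 0 1).real B ≤ theta γ r := by
  set c := Real.log γ / r + r / 2 with hc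
  have hreal (m : ℝ) (A : Set ℝ) :
      (gaussianReal m 1).real A = ∫ x in A, gaussianPDFReal m 1 x := by
    rw [Measure.real, gaussianReal_apply_eq_integral _ one_ne_zero,
      ENNReal.toReal_ofReal (integral_nonneg fun x ↦ gaussianPDFReal_nonneg _ _ _)]
  set h : ℝ → ℝ := fun x ↦ gaussianPDFReal r 1 x - γ * gaussianPDFReal 0 1 x with hh
  have hint : Integrable h :=
    (integrable_gaussianPDFReal _ _).sub ((integrable_gaussianPDFReal _ _).const_mul _)
  have hsub (A : Set ℝ) :
      (gaussianReal r 1).real A - γ * (gaussianReal 0 1).real A = ∫ x in A, h x := by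
    rw [hreal, hreal, hh, integral_sub (integrable_gaussianPDFReal _ _).integrableOn
      ((integrable_gaussianPDFReal _ _).const_mul _).integrableOn, integral_const_mul]
  have hfac (x : ℝ) : h x = gaussianPDFReal 0 1 x
      * (Real.exp (r * x - r ^ 2 / 2) - Real.exp (Real.log γ)) := by
    rw [Real.exp_log (by linarith)]
    simp only [hh, gaussianPDFReal]
    rw [mul_sub, mul_assoc _ _ (Real.exp (r * x - r ^ 2 / 2)), ← Real.exp_add]
    rw [mul_comm γ]
    congr 3
    simp only [NNReal.coe_one]
    ring
  have hexp (x : ℝ) : Real.log γ ≤ r * x - r ^ 2 / 2 ↔ c ≤ x := by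
    have e : r * c = Real.log γ + r ^ 2 / 2 := by rw [hc]; field_simp
    rw [← mul_le_mul_iff_right₀ hr (b := c), e]
    constructor <;> intro <;> linarith
  have htheta : theta γ r = ∫ x in Set.Ioi c, h x := by
    rw [← hsub, gaussianReal_real_Ioi, gaussianReal_real_Ioi, theta, hc]
    ring_nf
  rw [hsub, htheta, ← integral_indicator hB, ← integral_indicator measurableSet_Ioi]
  refine integral_mono (hint.indicator hB) (hint.indicator measurableSet_Ioi) fun x ↦ ?_
  have hg := gaussianPDFReal_nonneg 0 1 x
  by_cases hx : c < x
  · have h0 : 0 ≤ h x := by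
      rw [hfac]
      exact mul_nonneg hg (sub_nonneg.2 (Real.exp_le_exp.2 ((hexp x).2 hx.le)))
    by_cases hxB : x ∈ B <;> simp [hx, hxB, h0]
  · have h0 : h x ≤ 0 := by
      rw [hfac]
      refine mul_nonpos_of_nonneg_of_nonpos hg (sub_nonpos.2 (Real.exp_le_exp.2 ?_))
      have e : r * c = Real.log γ + r ^ 2 / 2 := by rw [hc]; field_simp
      nlinarith [not_lt.1 hx]
    by_cases hxB : x ∈ B <;> simp [hx, hxB, h0]

theorem theta_nonneg {γ r : ℝ} (hγ : 1 ≤ γ) (hr : 0 < r) : 0 ≤ theta γ r := by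
  simpa using gaussianReal_sub_le_theta hγ hr MeasurableSet.empty

/-! ### Gaussian measures in `ℝ^d` -/

/-- For `‖v‖ ≤ 1`, a standard Gaussian vector can be written `t v + S y` with `t`, `y` independent
standard Gaussians, where `S = (I - v vᵀ)^{1/2}`. Allowing `‖v‖ < 1` makes it possible to split off
a one-dimensional Gaussian whose shift is longer than that of the vector. -/
theorem stdGaussian_eq_map_prod {d : ℕ} {v : Euc d} (hv : ‖v‖ ≤ 1) :
    ∃ S : Euc d →L[ℝ] Euc d, stdGaussian (Euc d)
      = ((gaussianReal 0 1).prod (stdGaussian (Euc d))).map (fun p ↦ p.1 • v + S p.2) := by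
  set q := √(1 - ‖v‖ ^ 2) with hq
  have hq0 : 0 ≤ q := Real.sqrt_nonneg _
  have hq2 : q ^ 2 = 1 - ‖v‖ ^ 2 := Real.sq_sqrt (by nlinarith [norm_nonneg v])
  -- `I - k v vᵀ` is the square root of `I - v vᵀ`: the condition is `2 k - k² ‖v‖² = 1`.
  set k := 1 / (1 + q) with hk
  have hkq : k * (1 + q) = 1 := by rw [hk]; field_simp
  set S : Euc d →L[ℝ] Euc d :=
    ContinuousLinearMap.id ℝ _ - k • (innerSL ℝ v).smulRight v with hS
  have hSapp (y : Euc d) : S y = y - (k * inner ℝ v y) • v := by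
    simp [hS, smul_smul]
  have hsymm (y t : Euc d) : inner ℝ (S y) t = inner ℝ y (S t) := by
    rw [hSapp, hSapp, inner_sub_left, inner_sub_right, inner_smul_left, inner_smul_right,
      real_inner_comm y v]
    simp; ring
  have hnorm (t : Euc d) : ‖S t‖ ^ 2 = ‖t‖ ^ 2 - inner ℝ v t ^ 2 := by
    rw [hSapp, norm_sub_sq_real, inner_smul_right, norm_smul, real_inner_comm v t, mul_pow,
      Real.norm_eq_abs, sq_abs]
    have : k ^ 2 * ‖v‖ ^ 2 = 2 * k - 1 := by
      have : ‖v‖ ^ 2 = 1 - q ^ 2 := by linarith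
      rw [this]
      linear_combination (k * (1 - q) - 1) * hkq
    linear_combination (inner ℝ v t) ^ 2 * this
  refine ⟨S, Measure.ext_of_charFun ?_⟩
  ext t
  have hmeas : Measurable (fun p : ℝ × Euc d ↦ p.1 • v + S p.2) := by fun_prop
  rw [charFun_stdGaussian, charFun_apply, integral_map hmeas.aemeasurable (by fun_prop)]
  have e (p : ℝ × Euc d) :
      Complex.exp ((inner ℝ (p.1 • v + S p.2) t : ℝ) * Complex.I)
        = Complex.exp (((inner ℝ v t : ℝ) : ℂ) * p.1 * Complex.I)
          * Complex.exp ((inner ℝ p.2 (S t) : ℝ) * Complex.I) := by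
    rw [← Complex.exp_add, inner_add_left, inner_smul_left, hsymm]
    push_cast
    congr 1
    simp; ring
  simp_rw [e]
  rw [integral_prod_mul (f := fun x : ℝ ↦ Complex.exp (((inner ℝ v t : ℝ) : ℂ) * x * Complex.I))
    (g := fun y : Euc d ↦ Complex.exp ((inner ℝ y (S t) : ℝ) * Complex.I)),
    ← charFun_apply_real, ← charFun_apply, charFun_stdGaussian, charFun_gaussianReal,
    ← Complex.exp_add]
  congr 1
  have := congrArg (fun x : ℝ ↦ (x : ℂ)) (hnorm t)
  push_cast at this
  rw [this]
  simp
  ring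

/-- The test-set bound `N(m, σ²I)(A) - γ N(m', σ²I)(A) ≤ θ_γ(D / σ)` for means at distance at most
`D`. -/
theorem stdGaussian_affine_sub_le_theta {d : ℕ} {γ σ D : ℝ} (hγ : 1 ≤ γ) (hσ : 0 < σ) (hD : 0 < D)
    {m m' : Euc d} (hm : dist m m' ≤ D) {A : Set (Euc d)} (hA : MeasurableSet A) :
    (stdGaussian (Euc d)).real {z | m + σ • z ∈ A}
      - γ * (stdGaussian (Euc d)).real {z | m' + σ • z ∈ A} ≤ theta γ (D / σ) := by
  -- Dividing by `D` and not by `dist m m'` makes the one-dimensional shift equal to `D / σ`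
  -- exactly, so that neither monotonicity of `theta γ` nor a separate case `m = m'` is needed.
  set v : Euc d := D⁻¹ • (m - m') with hv
  have hv1 : ‖v‖ ≤ 1 := by
    rw [hv, norm_smul, Real.norm_of_nonneg (by positivity), ← dist_eq_norm,
      inv_mul_le_iff₀ hD]
    simpa using hm
  have hr : 0 < D / σ := by positivity
  obtain ⟨S, hS⟩ := stdGaussian_eq_map_prod hv1
  have hmm : m = m' + σ • (D / σ) • v := by
    rw [hv, smul_smul, smul_smul]
    have : σ * (D / σ) * D⁻¹ = 1 := by field_simp
    simp [mul_assoc] at this ⊢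
    simp [this]
  have hdis (w : Euc d) :
      (stdGaussian (Euc d)).real {z | w + σ • z ∈ A}
        = ∫ y, (gaussianReal 0 1).real {t | w + σ • (t • v + S y) ∈ A}
            ∂(stdGaussian (Euc d)) := by
    have hA' : MeasurableSet {z | w + σ • z ∈ A} :=
      hA.preimage (f := fun z ↦ w + σ • z) (by fun_prop)
    have hA'' : MeasurableSet {p : ℝ × Euc d | w + σ • (p.1 • v + S p.2) ∈ A} :=
      hA.preimage (f := fun p : ℝ × Euc d ↦ w + σ • (p.1 • v + S p.2)) (by fun_prop)
    conv_lhs => rw [hS]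
    rw [map_measureReal_apply (by fun_prop) hA', measureReal_def]
    change (((gaussianReal 0 1).prod (stdGaussian (Euc d)))
      {p : ℝ × Euc d | w + σ • (p.1 • v + S p.2) ∈ A}).toReal = _
    rw [Measure.prod_apply_symm hA'', ← integral_toReal
      (measurable_measure_prodMk_right hA'').aemeasurable
      (ae_of_all _ fun _ ↦ measure_lt_top _ _)]
    rfl
  have hint (w : Euc d) : Integrable
      (fun y ↦ (gaussianReal 0 1).real {t | w + σ • (t • v + S y) ∈ A}) (stdGaussian (Euc d)) := by
    have hA'' : MeasurableSet {p : ℝ × Euc d | w + σ • (p.1 • v + S p.2) ∈ A} :=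
      hA.preimage (f := fun p : ℝ × Euc d ↦ w + σ • (p.1 • v + S p.2)) (by fun_prop)
    refine Integrable.of_bound (C := 1)
      (measurable_measure_prodMk_right hA'').ennreal_toReal.aestronglyMeasurable
      (ae_of_all _ fun y ↦ ?_)
    rw [Real.norm_of_nonneg measureReal_nonneg]
    exact measureReal_le_one
  rw [hdis m, hdis m', ← integral_const_mul, ← integral_sub (hint m) ((hint m').const_mul γ)]
  calc _ ≤ ∫ _, theta γ (D / σ) ∂(stdGaussian (Euc d)) := by
        refine integral_mono ((hint m).sub ((hint m').const_mul γ)) (integrable_const _)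
          fun y ↦ ?_
        have hB : MeasurableSet {t : ℝ | m' + σ • (t • v + S y) ∈ A} :=
          hA.preimage (f := fun t : ℝ ↦ m' + σ • (t • v + S y)) (by fun_prop)
        refine le_trans (le_of_eq ?_) (gaussianReal_sub_le_theta hγ hr hB)
        have h := gaussianReal_map_add_const (μ := 0) (v := 1) (D / σ)
        rw [zero_add] at h
        rw [← h, map_measureReal_apply (by fun_prop) hB]
        congr 3
        ext t
        simp only [Set.mem_ofPred_eq]
        rw [hmm]
        have : m' + σ • (D / σ) • v + σ • (t • v + S y)
          = m' + σ • ((t + D / σ) • v + S y) := by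
          simp only [smul_add, add_smul]; abel
        rw [this]
    _ = _ := by simp

/-! ### The projection -/

theorem dist_projOnto_le {d : ℕ} {K : Set (Euc d)} (hne : K.Nonempty) (hcl : IsClosed K)
    (hcv : Convex ℝ K) (x y : Euc d) :
    dist (projOnto K hne hcl x) (projOnto K hne hcl y) ≤ dist x y := by
  have key (x : Euc d) (w : Euc d) (hw : w ∈ K) :
      inner ℝ (x - (projOnto K hne hcl x : Euc d)) (w - (projOnto K hne hcl x : Euc d)) ≤ 0 := by
    refine (norm_eq_iInf_iff_real_inner_le_zero hcv (projOnto K hne hcl x).2).1 ?_ w hw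
    have : Nonempty K := hne.to_subtype
    apply le_antisymm
    · exact le_ciInf fun w => by simpa [dist_eq_norm] using projOnto_dist K hne hcl x w.2
    · exact ciInf_le (f := fun w : K => ‖x - (w : Euc d)‖)
        ⟨0, by rintro _ ⟨w, rfl⟩; exact norm_nonneg _⟩ (projOnto K hne hcl x)
  have h1 := key x _ (projOnto K hne hcl y).2
  have h2 := key y _ (projOnto K hne hcl x).2
  rw [Subtype.dist_eq, dist_eq_norm, dist_eq_norm]
  set p : Euc d := ↑(projOnto K hne hcl x)
  set q : Euc d := ↑(projOnto K hne hcl y)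
  have h3 : ‖p - q‖ ^ 2 ≤ inner ℝ (x - y) (p - q) := by
    have e : inner ℝ (x - y) (p - q) - inner ℝ (p - q) (p - q)
        = - (inner ℝ (x - p) (q - p) + inner ℝ (y - q) (p - q)) := by
      simp only [inner_sub_left, inner_sub_right]; ring
    rw [← real_inner_self_eq_norm_sq]
    linarith
  have h4 := real_inner_le_norm (x - y) (p - q)
  by_contra! hlt
  nlinarith [norm_nonneg (x - y), norm_nonneg (p - q)]

theorem measurable_projOnto {d : ℕ} {K : Set (Euc d)} (hne : K.Nonempty) (hcl : IsClosed K)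
    (hcv : Convex ℝ K) : Measurable (projOnto K hne hcl) :=
  (LipschitzWith.of_dist_le_mul (K := 1) fun x y ↦ by
    simpa using dist_projOnto_le hne hcl hcv x y).continuous.measurable

/-! ### One step of the iteration -/

/-- The one-step contraction: the noisy map `w ↦ projOnto (ψ w + σ z)` shrinks `E_γ` by the factor
`θ_γ(D / σ)`. The projection costs nothing, being absorbed into the test set. -/
theorem EGamma_map_projOnto_step_le {d : ℕ} {K : Set (Euc d)} (hne : K.Nonempty)
    (hcl : IsClosed K) (hcv : Convex ℝ K) {ψ : K → Euc d} (hψ : Measurable ψ) {σ D γ : ℝ}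
    (hσ : 0 < σ) (hD : 0 < D) (hγ : 1 ≤ γ) (hdist : ∀ x y, dist (ψ x) (ψ y) ≤ D)
    (μ ν : Measure K) [IsProbabilityMeasure μ] [IsProbabilityMeasure ν] :
    EGamma γ
        ((μ.prod (stdGaussian (Euc d))).map (fun p ↦ projOnto K hne hcl (ψ p.1 + σ • p.2)))
        ((ν.prod (stdGaussian (Euc d))).map (fun p ↦ projOnto K hne hcl (ψ p.1 + σ • p.2)))
      ≤ theta γ (D / σ) * EGamma γ μ ν := by
  have hmeas : Measurable fun p : K × Euc d ↦ projOnto K hne hcl (ψ p.1 + σ • p.2) :=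
    (measurable_projOnto hne hcl hcv).comp (by fun_prop)
  obtain ⟨A, hA, hEA⟩ := exists_EGamma_eq γ
    ((μ.prod (stdGaussian (Euc d))).map (fun p ↦ projOnto K hne hcl (ψ p.1 + σ • p.2)))
    ((ν.prod (stdGaussian (Euc d))).map (fun p ↦ projOnto K hne hcl (ψ p.1 + σ • p.2)))
  set f : K → ℝ := fun w ↦
    (stdGaussian (Euc d)).real {z | ψ w + σ • z ∈ projOnto K hne hcl ⁻¹' A} with hf
  have hA' : MeasurableSet {p : K × Euc d | projOnto K hne hcl (ψ p.1 + σ • p.2) ∈ A} :=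
    hmeas hA
  have hfm : Measurable f := (measurable_measure_prodMk_left hA').ennreal_toReal
  have hdis (ρ : Measure K) [IsProbabilityMeasure ρ] :
      ((ρ.prod (stdGaussian (Euc d))).map
        (fun p ↦ projOnto K hne hcl (ψ p.1 + σ • p.2))).real A = ∫ w, f w ∂ρ := by
    rw [map_measureReal_apply hmeas hA, measureReal_def]
    change ((ρ.prod (stdGaussian (Euc d)))
      {p : K × Euc d | projOnto K hne hcl (ψ p.1 + σ • p.2) ∈ A}).toReal = _
    rw [Measure.prod_apply hA', ← integral_toReal (measurable_measure_prodMk_left hA').aemeasurable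
      (ae_of_all _ fun _ ↦ measure_lt_top _ _)]
    rfl
  rw [hEA, hdis μ, hdis ν]
  refine integral_sub_le_mul_EGamma hγ μ ν hfm (fun _ ↦ measureReal_nonneg)
    (fun _ ↦ measureReal_le_one) fun x y ↦ ?_
  have := stdGaussian_affine_sub_le_theta hγ hσ hD (hdist x y)
    (measurable_projOnto hne hcl hcv hA)
  simp only [hf]
  linarith

/-! ### The Markov property of the iteration -/

namespace IsProjectedNoisyIteration

variable {d n : ℕ} {K : Set (Euc d)} {hne : K.Nonempty} {hcl : IsClosed K}
  {Ψ : Fin n → K → Euc d} {σ : Fin n → ℝ} {μ₁ : Measure K} {Ω : Type*} [MeasurableSpace Ω]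
  {P : Measure Ω} {Z : Fin n → Ω → Euc d} {W : Fin (n + 1) → Ω → K}

/-- Each iterate is almost surely a measurable function of the initial point and of the earlier
noise only. The later noise is masked by zeros, which avoids noise spaces of varying dimension. -/
theorem exists_measurable_eq (hW : IsProjectedNoisyIteration K hne hcl Ψ σ μ₁ P Z W)
    (hcv : Convex ℝ K) (hΨ : ∀ t, Measurable (Ψ t)) (k : Fin (n + 1)) :
    ∃ g : K × (Fin n → Euc d) → K, Measurable g ∧
      W k =ᵐ[P] fun ω ↦ g (W 0 ω, fun j ↦ if j.castSucc < k then Z j ω else 0) := by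
  induction k using Fin.induction with
  | zero => exact ⟨Prod.fst, measurable_fst, ae_of_all _ fun _ ↦ rfl⟩
  | succ t ih =>
    obtain ⟨g, hg, hgW⟩ := ih
    -- `g` may depend on all coordinates, so the noise from time `t` on is masked again before
    -- applying it; the new iterate then uses `g` on the masked noise and the coordinate `t`.
    let trunc : (Fin n → Euc d) → (Fin n → Euc d) :=
      fun z j ↦ if j.castSucc < t.castSucc then z j else 0
    have htrunc : Measurable trunc := measurable_pi_lambda _ fun j ↦ by
      by_cases h : j.castSucc < t.castSucc <;> simp only [trunc, h, if_true, if_false] <;> fun_prop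
    refine ⟨fun p ↦ projOnto K hne hcl (Ψ t (g (p.1, trunc p.2)) + σ t • p.2 t),
      (measurable_projOnto hne hcl hcv).comp ?_, ?_⟩
    · have := hΨ t
      fun_prop
    · filter_upwards [hgW, hW.step t] with ω h1 h2
      rw [h2, h1]
      congr 4
      · congr 2
        funext j
        by_cases h : j < t
        · simp [trunc, h, h.le]
        · simp [trunc, h]
      · simp

theorem aemeasurable (hW : IsProjectedNoisyIteration K hne hcl Ψ σ μ₁ P Z W)
    (hcv : Convex ℝ K) (hΨ : ∀ t, Measurable (Ψ t)) (k : Fin (n + 1)) : AEMeasurable (W k) P := by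
  obtain ⟨g, hg, hgW⟩ := hW.exists_measurable_eq hcv hΨ k
  refine (hg.comp_aemeasurable (hW.init_law.aemeasurable.prodMk ?_)).congr hgW.symm
  refine aemeasurable_pi_lambda _ fun j ↦ ?_
  by_cases h : j.castSucc < k <;> simp only [h, if_true, if_false]
  · exact (hW.noise_law j).aemeasurable
  · fun_prop

theorem indepFun_noise [IsProbabilityMeasure P]
    (hW : IsProjectedNoisyIteration K hne hcl Ψ σ μ₁ P Z W)
    (hcv : Convex ℝ K) (hΨ : ∀ t, Measurable (Ψ t)) (t : Fin n) :
    IndepFun (W t.castSucc) (Z t) P := by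
  obtain ⟨g, hg, hgW⟩ := hW.exists_measurable_eq hcv hΨ t.castSucc
  have hZ (j) : AEMeasurable (Z j) P := (hW.noise_law j).aemeasurable
  set L : Ω → Fin n → Euc d := fun ω j ↦ if j.castSucc < t.castSucc then Z j ω else 0 with hL
  have hLm : AEMeasurable L P := aemeasurable_pi_lambda _ fun j ↦ by
    by_cases h : j.castSucc < t.castSucc <;> simp only [hL, h, if_true, if_false]
    · exact hZ j
    · fun_prop
  have hW0 : AEMeasurable (W 0) P := hW.init_law.aemeasurable
  have hLZ : IndepFun L (Z t) P := by
    have h := hW.noise_indep.indepFun_finset₀ (Finset.univ.filter (· < t)) {t} (by simp) hZ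
    let φ : ((Finset.univ.filter (· < t) : Finset (Fin n)) → Euc d) → Fin n → Euc d :=
      fun z j ↦ if h : j < t then z ⟨j, by simp [h]⟩ else 0
    have hφ : Measurable φ := measurable_pi_lambda _ fun j ↦ by
      by_cases h : j < t <;> simp only [φ, h, dif_pos, dif_neg, not_false_eq_true] <;> fun_prop
    have h' := h.comp hφ (measurable_pi_apply (⟨t, by simp⟩ : ({t} : Finset (Fin n))))
    convert h' using 1
    · ext ω j
      by_cases h : j < t <;> simp [hL, φ, h]
    · rfl
  have hWLZ : IndepFun (W 0) (fun ω ↦ (L ω, Z t ω)) P := by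
    let φ : (Fin n → Euc d) → (Fin n → Euc d) × Euc d :=
      fun z ↦ (fun j ↦ if j.castSucc < t.castSucc then z j else 0, z t)
    have hφ : Measurable φ := by
      refine Measurable.prodMk (measurable_pi_lambda _ fun j ↦ ?_) (measurable_pi_apply t)
      by_cases h : j.castSucc < t.castSucc <;> simp only [h, if_true, if_false] <;> fun_prop
    exact hW.init_indep_noise.comp measurable_id hφ
  have hpair : IndepFun (fun ω ↦ (W 0 ω, L ω)) (Z t) P := by
    rw [indepFun_iff_map_prod_eq_prod_map_map hLm (hZ t)] at hLZ
    have hWL : IndepFun (W 0) L P := hWLZ.comp measurable_id measurable_fst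
    rw [indepFun_iff_map_prod_eq_prod_map_map hW0 hLm] at hWL
    rw [indepFun_iff_map_prod_eq_prod_map_map hW0 (hLm.prodMk (hZ t)), hLZ] at hWLZ
    rw [indepFun_iff_map_prod_eq_prod_map_map (hW0.prodMk hLm) (hZ t), hWL]
    have : IsProbabilityMeasure (P.map (W 0)) := Measure.isProbabilityMeasure_map hW0
    have : IsProbabilityMeasure (P.map L) := Measure.isProbabilityMeasure_map hLm
    have : IsProbabilityMeasure (P.map (Z t)) := Measure.isProbabilityMeasure_map (hZ t)
    -- Both `W 0 ⊥ (L, Z t)` and `L ⊥ Z t` are product-law identities; reassociating the triple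
    -- product of laws gives `(W 0, L) ⊥ Z t`.
    rw [← (measurePreserving_prodAssoc (P.map (W 0)) (P.map L) (P.map (Z t))).symm.map_eq, ← hWLZ,
      AEMeasurable.map_map_of_aemeasurable (by fun_prop) (hW0.prodMk (hLm.prodMk (hZ t)))]
    rfl
  exact (hpair.comp hg measurable_id).congr hgW.symm (ae_of_all _ fun _ ↦ rfl)

/-- The law of the next iterate, in the form that the one-step contraction needs. -/
theorem map_succ_eq [IsProbabilityMeasure P]
    (hW : IsProjectedNoisyIteration K hne hcl Ψ σ μ₁ P Z W)
    (hcv : Convex ℝ K) (hΨ : ∀ t, Measurable (Ψ t)) (t : Fin n) :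
    P.map (W t.succ) = ((P.map (W t.castSucc)).prod (stdGaussian (Euc d))).map
      (fun p ↦ projOnto K hne hcl (Ψ t p.1 + σ t • p.2)) := by
  have hWm := hW.aemeasurable hcv hΨ t.castSucc
  have hZm := (hW.noise_law t).aemeasurable
  have hmeas : Measurable fun p : K × Euc d ↦ projOnto K hne hcl (Ψ t p.1 + σ t • p.2) :=
    (measurable_projOnto hne hcl hcv).comp (by have := hΨ t; fun_prop)
  rw [← (hW.noise_law t).map_eq,
    ← (indepFun_iff_map_prod_eq_prod_map_map hWm hZm).1 (hW.indepFun_noise hcv hΨ t),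
    AEMeasurable.map_map_of_aemeasurable hmeas.aemeasurable (hWm.prodMk hZm)]
  exact Measure.map_congr (hW.step t)

end IsProjectedNoisyIteration

/-! ### The contraction over all steps -/

theorem theorem1 {d n : ℕ} (K : Set (Euc d)) (hne : K.Nonempty) (hcl : IsClosed K)
    (hcv : Convex ℝ K)
    (Ψ : Fin n → K → Euc d) (hΨ : ∀ t, Measurable (Ψ t))
    (σ : Fin n → ℝ) (hσ : ∀ t, 0 < σ t)
    (D : ℝ) (hD : 0 < D) (hdiam : ∀ t, Metric.diam (Set.range (Ψ t)) = D)
    (γ : ℝ) (hγ : 1 ≤ γ)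
    (μ₁ μ₁' : Measure K) [IsProbabilityMeasure μ₁] [IsProbabilityMeasure μ₁']
    {Ω Ω' : Type*} [MeasurableSpace Ω] [MeasurableSpace Ω']
    (P : Measure Ω) [IsProbabilityMeasure P] (P' : Measure Ω') [IsProbabilityMeasure P']
    (Z : Fin n → Ω → Euc d) (W : Fin (n + 1) → Ω → K)
    (Z' : Fin n → Ω' → Euc d) (W' : Fin (n + 1) → Ω' → K)
    (hW : IsProjectedNoisyIteration K hne hcl Ψ σ μ₁ P Z W)
    (hW' : IsProjectedNoisyIteration K hne hcl Ψ σ μ₁' P' Z' W') :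
    EGamma γ (P.map (W (Fin.last n))) (P'.map (W' (Fin.last n)))
      ≤ EGamma γ μ₁ μ₁' * ∏ t, theta γ (D / σ t) := by
  -- `Metric.diam` is `0` on unbounded sets, so `0 < D` makes the range of `Ψ t` bounded.
  have hdist (t : Fin n) (x y : K) : dist (Ψ t x) (Ψ t y) ≤ D := by
    have hb : Bornology.IsBounded (Set.range (Ψ t)) := by
      by_contra h
      have := Metric.diam_eq_zero_of_unbounded h
      linarith [hdiam t]
    exact hdiam t ▸ Metric.dist_le_diam_of_mem hb ⟨x, rfl⟩ ⟨y, rfl⟩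
  have main (m : ℕ) (hm : m ≤ n) :
      EGamma γ (P.map (W ⟨m, by omega⟩)) (P'.map (W' ⟨m, by omega⟩))
        ≤ EGamma γ μ₁ μ₁' * ∏ i : Fin m, theta γ (D / σ (Fin.castLE hm i)) := by
    induction m with
    | zero =>
      have e : P.map (W ⟨0, by omega⟩) = μ₁ := hW.init_law.map_eq
      have e' : P'.map (W' ⟨0, by omega⟩) = μ₁' := hW'.init_law.map_eq
      simp only [Finset.univ_eq_empty, Finset.prod_empty, mul_one, e, e', le_refl]
    | succ m ih =>
      set t : Fin n := ⟨m, hm⟩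
      have e := hW.map_succ_eq hcv hΨ t
      have e' := hW'.map_succ_eq hcv hΨ t
      have := Measure.isProbabilityMeasure_map (hW.aemeasurable hcv hΨ t.castSucc)
      have := Measure.isProbabilityMeasure_map (hW'.aemeasurable hcv hΨ t.castSucc)
      have hstep := EGamma_map_projOnto_step_le hne hcl hcv (hΨ t) (hσ t) hD hγ (hdist t)
        (P.map (W t.castSucc)) (P'.map (W' t.castSucc))
      simp only [← e, ← e'] at hstep
      rw [Fin.prod_univ_castSucc, ← mul_assoc, mul_comm _ (theta γ _)]
      exact hstep.trans (mul_le_mul_of_nonneg_left (ih (by omega))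
        (theta_nonneg hγ (div_pos hD (hσ t))))
  exact main n le_rfl
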